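/- Let $X$ be a sofic shift over a finite alphabet $A$, i.e. a closed shift-invariant subset of $A^{\mathbb Z}$ that is the image of a shift of finite type under a continuous, surjective, shift-commuting map. For a right-ray $x^+=x_0x_1x_2\cdots$ of a point of $X$, let $P_\infty(x^+)$ be the set of left-rays $y^-=\cdots y_{-2}y_{-1}$ such that $y^-x^+\in X$. The \emph{left Krieger cover} $K$ of $X$ is the labelled graph whose vertex set $K^0$ consists of all sets $P_\infty(x^+)$, with one edge labelled $a\in A$ from $P$ to $P'$ if and only if there is a right-ray $x^+$ of $X$ with $P=P_\infty(ax^+)$ and $P'=P_\infty(x^+)$. A vertex $P\in K^0$ is \emph{non-decomposable} if $V\subseteq K^0$ and $P=\bigcup_{Q\in V}Q$ imply $P\in V$. The \emph{generalized left Fischer cover} $G$ of $X$ is the labelled subgraph of $K$ induced by the set of all vertices from which there is a finite path (possibly of length $0$) to a non-decomposable vertex. Its edge shift $\mathsf X_G$ is the set of bi-infinite paths in $G$, with the shift map and the product topology, and its covering map $\pi\colon\mathsf X_G\to X$ reads off the labels of a path. A \emph{conjugacy} is a bijective, continuous, shift-commuting map. \textbf{Theorem.} The generalized left Fischer cover is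 canonical: if $X_1$ and $X_2$ are sofic shifts whose generalized left Fischer covers $G_1$ and $G_2$ have covering maps $\pi_i\colon\mathsf X_{G_i}\to X_i$, then for every conjugacy $\Phi\colon X_1\to X_2$ there is a conjugacy $\psi\colon\mathsf X_{G_1}\to\mathsf X_{G_2}$ such that $\Phi\circ\pi_1=\pi_2\circ\psi$. -/

import Mathlib

open SymbolicDynamics.FullShift

universe u v

namespace Sofic

/-! ### Shift spaces

A shift space over the finite discrete alphabet `A` is a `Subshift A ℤ`. -/

section Shifts

variable {A : Type u} {B : Type v} [TopologicalSpace A] [TopologicalSpace B]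

/-- The shift map `σ(x) i = x (i + 1)`, restricted to a shift space. -/
def shiftMap (X : Subshift A ℤ) : X.carrier → X.carrier :=
  (X.mapsTo 1).restrict (shift (1 : ℤ)) X.carrier X.carrier

/-- A factor map: continuous, surjective and shift commuting. -/
structure IsFactorMap {X : Subshift A ℤ} {Y : Subshift B ℤ}
    (f : X.carrier → Y.carrier) : Prop where
  continuous : Continuous f
  surjective : Function.Surjective f
  semiconj : Function.Semiconj f (shiftMap X) (shiftMap Y)

/-- A conjugacy: continuous, bijective and shift commuting. -/
structure IsConjugacy {X : Subshift A ℤ} {Y : Subshift B ℤ}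
    (f : X.carrier → Y.carrier) : Prop where
  continuous : Continuous f
  bijective : Function.Bijective f
  semiconj : Function.Semiconj f (shiftMap X) (shiftMap Y)

/-- The word `w` occurs in the bi-infinite sequence `x`. -/
def Occurs {A : Type u} (w : List A) (x : ℤ → A) : Prop :=
  ∃ i : ℤ, ∀ k : Fin w.length, x (i + (k : ℕ)) = w.get k

/-- `X` is a shift of finite type: it is the set of all bi-infinite sequences that contain
no word of some finite set `F` of forbidden words. -/
def IsSFT (X : Subshift A ℤ) : Prop :=
  ∃ F : Set (List A), F.Finite ∧ X.carrier = {x | ∀ w ∈ F, ¬ Occurs w x}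

/-- `X` is sofic: it is the image of a shift of finite type under a factor map. Up to renaming
letters, the finite alphabet of the shift of finite type is some `Fin n`. -/
def IsSofic (X : Subshift A ℤ) : Prop :=
  ∃ (n : ℕ) (Y : Subshift (Fin n) ℤ) (f : Y.carrier → X.carrier), IsSFT Y ∧ IsFactorMap f

end Shifts

/-! ### Labelled graphs -/

/-- A labelled directed graph with labels in `A`. -/
structure LabelledGraph (A : Type u) where
  /-- vertices -/
  V : Type u
  /-- edges -/
  E : Type u
  /-- the vertex where an edge starts -/
  s : E → V
  /-- the vertex where an edge ends -/
  r : E → V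
  /-- the labelling map -/
  label : E → A

namespace LabelledGraph

variable {A : Type u}

/-- Edges form a discrete alphabet. -/
instance (G : LabelledGraph A) : TopologicalSpace G.E := ⊥

instance (G : LabelledGraph A) : DiscreteTopology G.E := ⟨rfl⟩

/-- The labelled subgraph induced by a set `H` of vertices. -/
def induced (G : LabelledGraph A) (H : Set G.V) : LabelledGraph A where
  V := H
  E := {e : G.E // G.s e ∈ H ∧ G.r e ∈ H}
  s e := ⟨G.s e.1, e.2.1⟩
  r e := ⟨G.r e.1, e.2.2⟩
  label e := G.label e.1

/-- There is an edge from `u` to `v`. -/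
def Adj (G : LabelledGraph A) (u v : G.V) : Prop :=
  ∃ e : G.E, G.s e = u ∧ G.r e = v

/-- There is a finite path, possibly of length zero, from `u` to `v`. -/
def ConnectedTo (G : LabelledGraph A) (u v : G.V) : Prop :=
  Relation.ReflTransGen G.Adj u v

/-- The edge shift: all bi-infinite paths. -/
def edgeShift (G : LabelledGraph A) : Subshift G.E ℤ where
  carrier := {x | ∀ i : ℤ, G.r (x i) = G.s (x (i + 1))}
  isClosed := by
    have h : {x : ℤ → G.E | ∀ i : ℤ, G.r (x i) = G.s (x (i + 1))} =
        ⋂ i : ℤ, (fun x : ℤ → G.E => (x i, x (i + 1))) ⁻¹' {p | G.r p.1 = G.s p.2} := by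
      ext x
      simp
    rw [h]
    exact isClosed_iInter fun i => (isClosed_discrete _).preimage (by fun_prop)
  mapsTo := by
    intro g x hx i
    have h := hx (g + i)
    simpa [shift, add_assoc] using h

end LabelledGraph

/-! ### Predecessor sets and the left Krieger cover

A right-ray `x₀ x₁ x₂ ⋯` is the function `n ↦ xₙ`, and a left-ray `⋯ x₋₂ x₋₁` is the function
`n ↦ x₋₍ₙ₊₁₎`, which lists the letters from right to left. -/

section Krieger

variable {A : Type u}

/-- The bi-infinite sequence `y⁻ x⁺`, in which `x⁺` starts at position `0`. -/
def join (y x : ℕ → A) : ℤ → A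
  | Int.ofNat n => x n
  | Int.negSucc n => y n

/-- Adds a letter in front of a right-ray (or at the right end of a left-ray). -/
def cons (a : A) (x : ℕ → A) : ℕ → A
  | 0 => a
  | n + 1 => x n

variable [TopologicalSpace A]

/-- The set `X⁺` of right-rays of points of `X`. -/
def rightRays (X : Subshift A ℤ) : Set (ℕ → A) :=
  {r | ∃ x ∈ X.carrier, ∀ n : ℕ, r n = x n}

/-- The predecessor set `P_∞(x⁺)`: the left-rays `y⁻` that may precede `x⁺` in `X`. -/
def pred (X : Subshift A ℤ) (x : ℕ → A) : Set (ℕ → A) :=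
  {y | join y x ∈ X.carrier}

/-- The left Krieger cover: its vertices are the predecessor sets of the right-rays of `X`, and
there is one edge labelled `a` from `P` to `P'` if and only if `P = P_∞(a x⁺)` and
`P' = P_∞(x⁺)` for some `x⁺ ∈ X⁺`. -/
def kriegerCover (X : Subshift A ℤ) : LabelledGraph A where
  V := {P : Set (ℕ → A) // ∃ x ∈ rightRays X, P = pred X x}
  E := {e : {P : Set (ℕ → A) // ∃ x ∈ rightRays X, P = pred X x} × A ×
        {P : Set (ℕ → A) // ∃ x ∈ rightRays X, P = pred X x} //
      ∃ x ∈ rightRays X, e.1.1 = pred X (cons e.2.1 x) ∧ e.2.2.1 = pred X x}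
  s e := e.1.1
  r e := e.1.2.2
  label e := e.1.2.1

/-- The vertex `P` of the left Krieger cover is non-decomposable: whenever it is the union of a
set `V` of vertices, it belongs to `V`. -/
def NonDecomposable (X : Subshift A ℤ) (P : (kriegerCover X).V) : Prop :=
  ∀ V : Set (kriegerCover X).V, P.1 = ⋃ Q ∈ V, Q.1 → P ∈ V

/-- The generalized left Fischer cover: the subgraph of the left Krieger cover induced by the
vertices that are connected to a non-decomposable vertex. -/
def genFischerCover (X : Subshift A ℤ) : LabelledGraph A :=
  (kriegerCover X).induced
    {P | ∃ P' : (kriegerCover X).V, NonDecomposable X P' ∧ (kriegerCover X).ConnectedTo P P'}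

/-! ### The covering map -/

theorem cons_mem_of_edge (X : Subshift A ℤ) (e : (kriegerCover X).E) {y : ℕ → A}
    (hy : y ∈ ((kriegerCover X).s e).1) :
    cons ((kriegerCover X).label e) y ∈ ((kriegerCover X).r e).1 := by
  obtain ⟨⟨P, a, P'⟩, x, hx, h1, h2⟩ := e
  change y ∈ P.1 at hy
  change cons a y ∈ P'.1
  change P.1 = pred X (cons a x) at h1
  change P'.1 = pred X x at h2
  rw [h2]
  rw [h1] at hy
  have h := X.mapsTo 1 hy
  have hj : shift (1 : ℤ) (join y (cons a x)) = join (cons a y) x := by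
    funext i
    match i with
    | Int.ofNat n =>
      have : (1 : ℤ) + Int.ofNat n = Int.ofNat (n + 1) := by simp; ring
      simp only [shift_apply, this, join, cons]
    | Int.negSucc 0 => rfl
    | Int.negSucc (n + 1) =>
      have : (1 : ℤ) + Int.negSucc (n + 1) = Int.negSucc n := by omega
      simp only [shift_apply, this, join, cons]
  rw [hj] at h
  exact h

/-- The label sequence of a bi-infinite path in the left Krieger cover of `X` is a point of
`X`. -/
theorem label_mem_of_path (X : Subshift A ℤ) (x : ℤ → (kriegerCover X).E)
    (hx : x ∈ (kriegerCover X).edgeShift.carrier) :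
    (fun i => (kriegerCover X).label (x i)) ∈ X.carrier := by
  have key : ∀ (i : ℤ) (k : ℕ), ∃ y ∈ ((kriegerCover X).s (x (i + k))).1,
      ∀ j : ℕ, j < k → y j = (kriegerCover X).label (x (i + k - 1 - j)) := by
    intro i k
    induction k with
    | zero =>
      obtain ⟨r, ⟨z, hz, hr⟩, hP⟩ := ((kriegerCover X).s (x (i + (0 : ℕ)))).2
      refine ⟨fun n => z (Int.negSucc n), ?_, fun j hj => absurd hj (Nat.not_lt_zero j)⟩
      rw [hP]
      have hj : join (fun n => z (Int.negSucc n)) r = z := by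
        funext m
        match m with
        | Int.ofNat n => exact hr n
        | Int.negSucc n => rfl
      simpa [pred, hj] using hz
    | succ k ih =>
      obtain ⟨y, hy, hyl⟩ := ih
      refine ⟨cons ((kriegerCover X).label (x (i + k))) y, ?_, ?_⟩
      · have h := cons_mem_of_edge X _ hy
        rw [hx (i + k)] at h
        have : i + ((k + 1 : ℕ) : ℤ) = i + k + 1 := by push_cast; ring
        rw [this]
        exact h
      · intro j hj
        match j with
        | 0 =>
          have : i + ((k + 1 : ℕ) : ℤ) - 1 - ((0 : ℕ) : ℤ) = i + k := by push_cast; ring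
          rw [this]
          rfl
        | j + 1 =>
          have : i + ((k + 1 : ℕ) : ℤ) - 1 - ((j + 1 : ℕ) : ℤ) = i + k - 1 - j := by
            push_cast; ring
          rw [this]
          exact hyl j (by omega)
  have approx : ∀ n : ℕ, ∃ z ∈ X.carrier, ∀ m : ℤ, -(n : ℤ) ≤ m → m < n →
      z m = (kriegerCover X).label (x m) := by
    intro n
    obtain ⟨y, hy, hyl⟩ := key (-(n : ℤ)) (2 * n)
    obtain ⟨r, -, hP⟩ := ((kriegerCover X).s (x (-(n : ℤ) + (2 * n : ℕ)))).2
    rw [hP] at hy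
    refine ⟨shift (-(n : ℤ)) (join y r), X.mapsTo _ hy, ?_⟩
    intro m h1 h2
    have hm : -(n : ℤ) + m = Int.negSucc (n - 1 - m).toNat := by omega
    rw [shift_apply, hm]
    change y _ = _
    rw [hyl _ (by omega)]
    congr 2
    push_cast
    omega
  choose z hz hzm using approx
  refine X.isClosed.mem_of_tendsto (f := z) (b := Filter.atTop) ?_
    (Filter.Eventually.of_forall hz)
  rw [tendsto_pi_nhds]
  intro m
  refine tendsto_nhds_of_eventually_eq ?_
  filter_upwards [Filter.eventually_ge_atTop (m.natAbs + 1)] with n hn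
  exact hzm n m (by omega) (by omega)

/-- The covering map of the generalized left Fischer cover of `X`: it reads the labels of a
bi-infinite path. -/
def coveringMap (X : Subshift A ℤ) (x : (genFischerCover X).edgeShift.carrier) : X.carrier :=
  ⟨fun i => (genFischerCover X).label (x.1 i),
    label_mem_of_path X (fun i => (x.1 i).1) fun i => congrArg Subtype.val (x.2 i)⟩

end Krieger

end Sofic

/-! By compactness a conjugacy `f` and its inverse `g` are sliding block codes of a common radius
`N`. Everything rests on exchanging tails: carry a point to the other shift, replace its right-ray
by one that admits the same past, and carry it back. Block codes disturb only a bounded zone around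
the cut.

Exchanging tails shows that the predecessor set of `f x` at `i` depends only on a finite block of
`x` and the predecessor set of `x` at any `n ≥ i + 3N` (`InverseCodes.past_eq`). A bi-infinite path
in the Krieger cover need not come from a single point, but each of its left halves does
(`exists_represents`), so applying `f` to such points lifts `f` to the Krieger covers. The lift of
`g` is inverse to it.

It remains to see that the lift preserves Fischer vertices
(`InverseCodes.vertexAt_mem_fischerVertices`). A non-decomposable `P` contains a left-ray `y` that
lies in no smaller vertex. In the image shift, finiteness of the vertex set gives a non-decomposable
`Q` inside the corresponding predecessor set and containing the image past. Following `Q` and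
pulling back yields a vertex inside `P` that contains `y`, hence `P` itself; so the image path can
be continued to `Q`. -/

namespace Sofic

/-! ### Sliding block codes -/

section BlockCodes

variable {A : Type u} {B : Type v} [TopologicalSpace A] [TopologicalSpace B]

/-- The shift by `i` positions on a shift space. -/
def shiftBy (X : Subshift A ℤ) (i : ℤ) (x : X.carrier) : X.carrier :=
  ⟨shift i x.1, X.mapsTo i x.2⟩

/-- `f` is a sliding block code: the letter `f x i` is determined by the letters of `x` at
distance at most `N` from `i`. -/
def IsBlockCode {X : Subshift A ℤ} {Y : Subshift B ℤ} (f : X.carrier → Y.carrier) (N : ℕ) :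
    Prop :=
  ∀ (x x' : X.carrier) (i : ℤ), (∀ j, i - N ≤ j → j ≤ i + N → x.1 j = x'.1 j) →
    (f x).1 i = (f x').1 i

theorem IsBlockCode.mono {X : Subshift A ℤ} {Y : Subshift B ℤ} {f : X.carrier → Y.carrier}
    {M N : ℕ} (hf : IsBlockCode f M) (h : M ≤ N) : IsBlockCode f N :=
  fun x x' i hx => hf x x' i fun j h1 h2 => hx j (by omega) (by omega)

theorem shiftBy_zero (X : Subshift A ℤ) (x : X.carrier) : shiftBy X 0 x = x := by
  ext k
  simp [shiftBy]

theorem shiftBy_add (X : Subshift A ℤ) (i j : ℤ) (x : X.carrier) :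
    shiftBy X (i + j) x = shiftBy X j (shiftBy X i x) := by
  ext k
  simp [shiftBy, shift_apply, add_assoc]

theorem shiftBy_injective (X : Subshift A ℤ) (i : ℤ) : Function.Injective (shiftBy X i) := by
  intro x y h
  have := congrArg (shiftBy X (-i)) h
  rwa [← shiftBy_add, ← shiftBy_add, add_neg_cancel, shiftBy_zero, shiftBy_zero] at this

theorem map_shiftBy {X : Subshift A ℤ} {Y : Subshift B ℤ} {f : X.carrier → Y.carrier}
    (hf : Function.Semiconj f (shiftMap X) (shiftMap Y)) (i : ℤ) (x : X.carrier) :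
    f (shiftBy X i x) = shiftBy Y i (f x) := by
  have one : ∀ x, f (shiftBy X 1 x) = shiftBy Y 1 (f x) := hf
  induction i generalizing x with
  | zero => rw [shiftBy_zero, shiftBy_zero]
  | succ n ih => rw [shiftBy_add, one, ih, shiftBy_add]
  | pred n ih =>
    apply shiftBy_injective Y 1
    rw [← one, ← shiftBy_add, ← shiftBy_add, sub_add_cancel, ih]

/-- Curtis–Hedlund–Lyndon. Pairs that agree on `[-N, N]` but have different images at `0` form
decreasing compact sets `C N`. A pair in all of them would have equal components, so some `C N` is
empty; shifting moves `0` to any `i`. -/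
theorem exists_isBlockCode [Finite A] [DiscreteTopology A] [DiscreteTopology B]
    {X : Subshift A ℤ} {Y : Subshift B ℤ} {f : X.carrier → Y.carrier} (hc : Continuous f)
    (hf : Function.Semiconj f (shiftMap X) (shiftMap Y)) : ∃ N, IsBlockCode f N := by
  have : CompactSpace X.carrier := isCompact_iff_compactSpace.mp X.isClosed.isCompact
  have hg : Continuous fun x => (f x).1 0 := (continuous_apply 0).comp
    (continuous_subtype_val.comp hc)
  have hev : ∀ j : ℤ, Continuous fun x : X.carrier => x.1 j := fun j =>
    (continuous_apply j).comp continuous_subtype_val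
  let C : ℕ → Set (X.carrier × X.carrier) := fun N =>
    {p | (f p.1).1 0 ≠ (f p.2).1 0} ∩ ⋂ j : ℤ, {p | -N ≤ j → j ≤ N → p.1.1 j = p.2.1 j}
  have hC : ∀ N, IsClosed (C N) := by
    intro N
    refine IsClosed.inter ?_ (isClosed_iInter fun j => ?_)
    · exact (isClosed_discrete {q : B × B | q.1 ≠ q.2}).preimage
        ((hg.comp continuous_fst).prodMk (hg.comp continuous_snd))
    · exact (isClosed_discrete {q : A × A | -(N : ℤ) ≤ j → j ≤ N → q.1 = q.2}).preimage
        (((hev j).comp continuous_fst).prodMk ((hev j).comp continuous_snd))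
  have hE : ∃ N, C N = ∅ := by
    by_contra! hne
    obtain ⟨p, hp⟩ := IsCompact.nonempty_iInter_of_sequence_nonempty_isCompact_isClosed C
      (fun N p hp => ⟨hp.1, Set.mem_iInter.2 fun j h1 h2 =>
        Set.mem_iInter.1 hp.2 j (by push_cast; omega) (by push_cast; omega)⟩)
      hne (hC 0).isCompact hC
    rw [Set.mem_iInter] at hp
    refine (hp 0).1 ?_
    have : p.1 = p.2 := by
      ext j
      exact Set.mem_iInter.1 (hp j.natAbs).2 j (by omega) (by omega)
    rw [this]
  obtain ⟨N, hN⟩ := hE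
  refine ⟨N, fun x x' i hx => ?_⟩
  by_contra hne
  have hm : (shiftBy X i x, shiftBy X i x') ∈ C N := by
    refine ⟨?_, Set.mem_iInter.2 fun j h1 h2 => hx (i + j) (by omega) (by omega)⟩
    change (f (shiftBy X i x)).1 0 ≠ (f (shiftBy X i x')).1 0
    rw [map_shiftBy hf, map_shiftBy hf]
    simpa [shiftBy] using hne
  rw [hN] at hm
  exact hm

/-- Mutually inverse sliding block codes. -/
structure InverseCodes {X : Subshift A ℤ} {Y : Subshift B ℤ} (f : X.carrier → Y.carrier)
    (g : Y.carrier → X.carrier) (N : ℕ) : Prop where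
  code : IsBlockCode f N
  code_inv : IsBlockCode g N
  left_inv : ∀ x, g (f x) = x
  right_inv : ∀ y, f (g y) = y
  shift : ∀ i x, f (shiftBy X i x) = shiftBy Y i (f x)

theorem InverseCodes.symm {X : Subshift A ℤ} {Y : Subshift B ℤ} {f : X.carrier → Y.carrier}
    {g : Y.carrier → X.carrier} {N : ℕ} (h : InverseCodes f g N) : InverseCodes g f N where
  code := h.code_inv
  code_inv := h.code
  left_inv := h.right_inv
  right_inv := h.left_inv
  shift i y := by rw [← h.right_inv y, ← h.shift, h.left_inv, h.left_inv]

theorem IsConjugacy.exists_inverseCodes [Finite A] [DiscreteTopology A] [Finite B]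
    [DiscreteTopology B] {X : Subshift A ℤ} {Y : Subshift B ℤ} {f : X.carrier → Y.carrier}
    (hf : IsConjugacy f) : ∃ g N, InverseCodes f g N := by
  have : CompactSpace X.carrier := isCompact_iff_compactSpace.mp X.isClosed.isCompact
  let e := Equiv.ofBijective f hf.bijective
  have he : Continuous e := hf.continuous
  have hl : ∀ x, e.symm (f x) = x := e.symm_apply_apply
  have hr : ∀ y, f (e.symm y) = y := e.apply_symm_apply
  obtain ⟨M, hM⟩ := exists_isBlockCode hf.continuous hf.semiconj
  obtain ⟨N, hN⟩ := exists_isBlockCode (f := e.symm)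
    (he.continuous_symm_of_equiv_compact_to_t2) fun y => by
      rw [← hr y]
      exact (congrArg e.symm (hf.semiconj _)).symm.trans (by rw [hl, hl])
  exact ⟨e.symm, max M N, hM.mono (le_max_left _ _), hN.mono (le_max_right _ _), hl, hr,
    map_shiftBy hf.semiconj⟩

end BlockCodes

/-! ### Gluing sequences -/

section Glue

variable {A : Type u}

/-- The sequence that agrees with `x` to the left of position `n` and with `y` from `n` on. -/
def glue (n : ℤ) (x y : ℤ → A) : ℤ → A := fun i => if i < n then x i else y i

theorem glue_of_lt {n i : ℤ} (h : i < n) (x y : ℤ → A) : glue n x y i = x i := if_pos h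

theorem glue_of_le {n i : ℤ} (h : n ≤ i) (x y : ℤ → A) : glue n x y i = y i :=
  if_neg (not_lt.2 h)

theorem glue_self (n : ℤ) (x : ℤ → A) : glue n x x = x := by
  funext i
  simp [glue]

/-- The left-ray of `x` that ends just before position `n`. -/
def leftRay (x : ℤ → A) (n : ℤ) : ℕ → A := fun k => x (n - 1 - k)

/-- The right-ray of `x` that starts at position `n`. -/
def rightRay (x : ℤ → A) (n : ℤ) : ℕ → A := fun k => x (n + k)

theorem join_leftRay_rightRay (x y : ℤ → A) (n : ℤ) :
    join (leftRay x n) (rightRay y n) = shift n (glue n x y) := by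
  funext i
  rw [shift_apply]
  match i with
  | Int.ofNat k =>
    rw [glue_of_le (by simp)]
    rfl
  | Int.negSucc k =>
    rw [glue_of_lt (by omega)]
    change x _ = x _
    congr 1
    omega

theorem exists_leftRay_eq (y : ℕ → A) (n : ℤ) : ∃ x, leftRay x n = y :=
  ⟨fun i => y (n - 1 - i).toNat, by funext k; simp [leftRay]⟩

theorem exists_rightRay_eq (y : ℕ → A) (n : ℤ) : ∃ x, rightRay x n = y :=
  ⟨fun i => y (i - n).toNat, by funext k; simp [rightRay]⟩

theorem rightRay_eq_cons (x : ℤ → A) (n : ℤ) :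
    rightRay x n = cons (x n) (rightRay x (n + 1)) := by
  funext k
  cases k with
  | zero => simp [rightRay, cons]
  | succ k =>
    simp only [rightRay, cons]
    congr 1
    push_cast
    ring

theorem leftRay_add_one (x : ℤ → A) (n : ℤ) :
    leftRay x (n + 1) = cons (x n) (leftRay x n) := by
  funext k
  cases k with
  | zero => simp [leftRay, cons]
  | succ k =>
    simp only [leftRay, cons]
    congr 1
    push_cast
    ring

theorem leftRay_congr {x y : ℤ → A} {n : ℤ} (h : ∀ i < n, x i = y i) :
    leftRay x n = leftRay y n :=
  funext fun k => h _ (by omega)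

theorem rightRay_congr {x y : ℤ → A} {n : ℤ} (h : ∀ i, n ≤ i → x i = y i) :
    rightRay x n = rightRay y n :=
  funext fun k => h _ (by omega)

end Glue

/-! ### Predecessor sets as gluing conditions -/

section Past

variable {A : Type u} [TopologicalSpace A]

/-- The predecessor set of the right-ray of `x` that starts at position `n`. -/
def past (X : Subshift A ℤ) (x : ℤ → A) (n : ℤ) : Set (ℕ → A) := pred X (rightRay x n)

theorem shift_mem_iff (X : Subshift A ℤ) (n : ℤ) (x : ℤ → A) :
    shift n x ∈ X.carrier ↔ x ∈ X.carrier := by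
  refine ⟨fun h => ?_, fun h => X.mapsTo n h⟩
  have := X.mapsTo (-n) h
  rwa [show shift (-n) (shift n x) = x by funext i; simp [shift_apply]] at this

theorem leftRay_mem_past {X : Subshift A ℤ} {x y : ℤ → A} {n : ℤ} :
    leftRay x n ∈ past X y n ↔ glue n x y ∈ X.carrier := by
  change join _ _ ∈ X.carrier ↔ _
  rw [join_leftRay_rightRay, shift_mem_iff]

theorem past_subset_iff {X : Subshift A ℤ} {x y : ℤ → A} {n : ℤ} :
    past X x n ⊆ past X y n ↔
      ∀ z, glue n z x ∈ X.carrier → glue n z y ∈ X.carrier := by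
  refine ⟨fun h z hz => leftRay_mem_past.1 (h (leftRay_mem_past.2 hz)), fun h y hy => ?_⟩
  obtain ⟨z, rfl⟩ := exists_leftRay_eq y n
  exact leftRay_mem_past.2 (h z (leftRay_mem_past.1 hy))

theorem past_congr {X : Subshift A ℤ} {x y : ℤ → A} {n : ℤ} (h : ∀ i, n ≤ i → x i = y i) :
    past X x n = past X y n := by
  rw [past, past, rightRay_congr h]

theorem mem_pred_cons (X : Subshift A ℤ) (a : A) (x y : ℕ → A) :
    y ∈ pred X (cons a x) ↔ cons a y ∈ pred X x := by
  obtain ⟨z, rfl⟩ := exists_leftRay_eq y 0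
  obtain ⟨w, rfl⟩ := exists_rightRay_eq x 1
  let w' : ℤ → A := glue 1 (fun _ => a) w
  have h1 : cons a (rightRay w 1) = rightRay w' 0 := by
    rw [rightRay_eq_cons w' 0, zero_add, rightRay_congr (x := w') (y := w) (n := 1)
      fun i hi => glue_of_le hi _ _]
    rfl
  have h2 : cons a (leftRay z 0) = leftRay (glue 0 z w') 1 := by
    have := leftRay_add_one (glue 0 z w') 0
    rw [zero_add] at this
    rw [this, leftRay_congr (x := glue 0 z w') (y := z) fun i hi => glue_of_lt hi _ _]
    rfl
  rw [h1, h2, show pred X (rightRay w' 0) = past X w' 0 from rfl,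
    show pred X (rightRay w 1) = past X w 1 from rfl, leftRay_mem_past, leftRay_mem_past]
  have h3 : glue 1 (glue 0 z w') w = glue 0 z w' := by
    funext i
    by_cases hi : i < 1
    · rw [glue_of_lt hi]
    · rw [glue_of_le (by omega), glue_of_le (by omega)]
      exact (glue_of_le (by omega) _ _).symm
  rw [h3]

/-- Prepending a letter acts on predecessor sets, not just on rays; hence the Krieger cover is
left-resolving. -/
theorem pred_cons_congr {X : Subshift A ℤ} {x y : ℕ → A} (h : pred X x = pred X y) (a : A) :
    pred X (cons a x) = pred X (cons a y) := by
  ext z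
  rw [mem_pred_cons, mem_pred_cons, h]

theorem past_of_past_eq {X : Subshift A ℤ} {x y : ℤ → A} {m n : ℤ} (hmn : m ≤ n)
    (h : past X x n = past X y n) (hxy : ∀ i, m ≤ i → i < n → x i = y i) :
    past X x m = past X y m := by
  obtain ⟨k, rfl⟩ := Int.le.dest hmn
  induction k with
  | zero => simpa using h
  | succ k ih =>
    refine ih (by omega) ?_ fun i h1 h2 => hxy i h1 (by omega)
    rw [past, past, rightRay_eq_cons, rightRay_eq_cons y, hxy (m + k) (by omega) (by omega)]
    refine pred_cons_congr ?_ _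
    have e : m + ((k + 1 : ℕ) : ℤ) = m + k + 1 := by push_cast; ring
    rwa [e] at h

theorem rightRay_mem {X : Subshift A ℤ} {x : ℤ → A} (hx : x ∈ X.carrier) (n : ℤ) :
    rightRay x n ∈ rightRays X :=
  ⟨shift n x, X.mapsTo n hx, fun _ => rfl⟩

end Past

/-! ### Predecessor sets under conjugacies -/

section Codes

variable {A : Type u} {B : Type v} [TopologicalSpace A] [TopologicalSpace B]
  {X : Subshift A ℤ} {Y : Subshift B ℤ} {f : X.carrier → Y.carrier} {g : Y.carrier → X.carrier}
  {N : ℕ}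

/-- Pull the past `z` followed by `f x` back to `g p`, exchange its tail from `n` on for that of
`x'`, and map the result `q` forward. The image agrees with `p` left of `n - N` and with `f x'` from
`i + 2N` on; these ranges cover all positions because `i + 3N ≤ n`. -/
theorem InverseCodes.past_subset (h : InverseCodes f g N) (x x' : X.carrier) {i n : ℤ}
    (hin : i + 3 * N ≤ n) (hxx : ∀ j, i - N ≤ j → j < n → x.1 j = x'.1 j)
    (hp : past X x.1 n ⊆ past X x'.1 n) : past Y (f x).1 i ⊆ past Y (f x').1 i := by
  rw [past_subset_iff] at hp ⊢
  intro z hz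
  let p : Y.carrier := ⟨_, hz⟩
  have hgp : ∀ j, i + N ≤ j → (g p).1 j = x.1 j := fun j hj => by
    rw [← h.left_inv x]
    exact h.code_inv _ _ j fun k h1 _ => glue_of_le (by omega) _ _
  have hq : glue n (g p).1 x'.1 ∈ X.carrier := hp _ <| by
    rw [show glue n (g p).1 x.1 = (g p).1 from ?_]
    · exact (g p).2
    · funext j
      by_cases hj : j < n
      · rw [glue_of_lt hj]
      · rw [glue_of_le (by omega), hgp j (by omega)]
  let q : X.carrier := ⟨_, hq⟩
  have hq1 : ∀ j < n - N, (f q).1 j = p.1 j := fun j hj => by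
    rw [← h.right_inv p]
    exact h.code _ _ j fun k _ h2 => glue_of_lt (by omega) _ _
  have hq2 : ∀ j, i + 2 * N ≤ j → (f q).1 j = (f x').1 j := fun j hj =>
    h.code _ _ j fun k h1 _ => by
      change glue n (g p).1 x'.1 k = _
      by_cases hk : k < n
      · rw [glue_of_lt hk, hgp k (by omega), hxx k (by omega) hk]
      · exact glue_of_le (by omega) _ _
  rw [show glue i z (f x').1 = (f q).1 from ?_]
  · exact (f q).2
  · funext j
    by_cases hj : j < i
    · rw [glue_of_lt hj, hq1 j (by omega)]
      exact (glue_of_lt hj _ _).symm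
    · rw [glue_of_le (by omega)]
      by_cases hj' : j < n - N
      · rw [hq1 j hj', show p.1 j = (f x).1 j from glue_of_le (by omega) _ _]
        exact h.code _ _ j fun k h1 h2 => (hxx k (by omega) (by omega)).symm
      · exact (hq2 j (by omega)).symm

theorem InverseCodes.past_eq (h : InverseCodes f g N) (x x' : X.carrier) {i n : ℤ}
    (hin : i + 3 * N ≤ n) (hxx : ∀ j, i - N ≤ j → j < n → x.1 j = x'.1 j)
    (hp : past X x.1 n = past X x'.1 n) : past Y (f x).1 i = past Y (f x').1 i :=
  (h.past_subset x x' hin hxx hp.subset).antisymm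
    (h.past_subset x' x hin (fun j h1 h2 => (hxx j h1 h2).symm) hp.symm.subset)

/-- If the right-ray of `f x` from `j` on is replaced by one with a smaller predecessor set, then
the predecessor set of the preimage at any position sufficiently far left of `j` is contained in
that of `x`. -/
theorem InverseCodes.past_subset_of_glue (h : InverseCodes f g N) (x : X.carrier) (y : ℤ → B)
    {n j : ℤ} (hj : n + 3 * N ≤ j) (hg : glue j (f x).1 y ∈ Y.carrier)
    (hp : past Y y j ⊆ past Y (f x).1 j) : past X (g ⟨_, hg⟩).1 n ⊆ past X x.1 n := by
  set p : Y.carrier := ⟨_, hg⟩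
  have hgp : ∀ i < j - N, (g p).1 i = x.1 i := fun i hi => by
    rw [← h.left_inv x]
    exact h.code_inv _ _ i fun k _ h2 => glue_of_lt (by omega) _ _
  rw [past_subset_iff] at hp ⊢
  intro z hz
  let q : X.carrier := ⟨_, hz⟩
  have hq : ∀ i, n + N ≤ i → (f q).1 i = p.1 i := fun i hi => by
    rw [← h.right_inv p]
    exact h.code _ _ i fun k h1 _ => glue_of_le (by omega) _ _
  -- The tail of `f q` from `j` on is `y`, so its past also admits the tail of `f x`.
  have hr : glue j (f q).1 (f x).1 ∈ Y.carrier := hp _ <| by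
    rw [show glue j (f q).1 y = (f q).1 from ?_]
    · exact (f q).2
    · funext i
      by_cases hi : i < j
      · rw [glue_of_lt hi]
      · rw [glue_of_le (by omega), hq i (by omega)]
        exact (glue_of_le (by omega) _ _).symm
  let r : Y.carrier := ⟨_, hr⟩
  have hr1 : ∀ i < j - N, (g r).1 i = q.1 i := fun i hi => by
    rw [← h.left_inv q]
    exact h.code_inv _ _ i fun k _ h2 => glue_of_lt (by omega) _ _
  have hr2 : ∀ i, n + 2 * N ≤ i → (g r).1 i = x.1 i := fun i hi => by
    rw [← h.left_inv x]
    refine h.code_inv _ _ i fun k h1 _ => ?_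
    change glue j (f q).1 (f x).1 k = _
    by_cases hk : k < j
    · rw [glue_of_lt hk, hq k (by omega)]
      exact glue_of_lt hk _ _
    · exact glue_of_le (by omega) _ _
  rw [show glue n z x.1 = (g r).1 from ?_]
  · exact (g r).2
  · funext i
    by_cases hi : i < n
    · rw [glue_of_lt hi, hr1 i (by omega)]
      exact (glue_of_lt hi _ _).symm
    · rw [glue_of_le (by omega)]
      by_cases hi' : i < j - N
      · rw [hr1 i hi', ← hgp i hi']
        exact (glue_of_le (by omega) _ _).symm
      · exact (hr2 i (by omega)).symm

end Codes

/-! ### Paths in the left Krieger cover -/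

section Paths

variable {A : Type u} [TopologicalSpace A] {X : Subshift A ℤ}

/-- The vertex of the left Krieger cover given by the right-ray of `x` that starts at `n`. -/
def vertexAt (x : X.carrier) (n : ℤ) : (kriegerCover X).V :=
  ⟨past X x.1 n, rightRay x.1 n, rightRay_mem x.2 n, rfl⟩

/-- The edge of the left Krieger cover given by the right-ray of `x` that starts at `n`. -/
def edgeAt (x : X.carrier) (n : ℤ) : (kriegerCover X).E :=
  ⟨(vertexAt x n, x.1 n, vertexAt x (n + 1)), rightRay x.1 (n + 1), rightRay_mem x.2 (n + 1),
    congrArg (pred X) (rightRay_eq_cons x.1 n), rfl⟩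

@[simp] theorem s_edgeAt (x : X.carrier) (n : ℤ) :
    (kriegerCover X).s (edgeAt x n) = vertexAt x n := rfl

@[simp] theorem r_edgeAt (x : X.carrier) (n : ℤ) :
    (kriegerCover X).r (edgeAt x n) = vertexAt x (n + 1) := rfl

@[simp] theorem label_edgeAt (x : X.carrier) (n : ℤ) :
    (kriegerCover X).label (edgeAt x n) = x.1 n := rfl

theorem leftRay_mem_vertexAt (x : X.carrier) (n : ℤ) : leftRay x.1 n ∈ (vertexAt x n).1 :=
  leftRay_mem_past.2 (by rw [glue_self]; exact x.2)

theorem exists_vertexAt_eq (P : (kriegerCover X).V) (n : ℤ) :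
    ∃ x : X.carrier, vertexAt x n = P := by
  obtain ⟨P, r, ⟨x, hx, hr⟩, rfl⟩ := P
  refine ⟨shiftBy X (-n) ⟨x, hx⟩, Subtype.ext ?_⟩
  change pred X _ = _
  congr 1
  funext k
  rw [hr]
  change x (-n + (n + k)) = x k
  rw [neg_add_cancel_left]

theorem vertex_nonempty (P : (kriegerCover X).V) : P.1.Nonempty := by
  obtain ⟨x, rfl⟩ := exists_vertexAt_eq P 0
  exact ⟨_, leftRay_mem_vertexAt x 0⟩

/-- The left Krieger cover is left-resolving. -/
theorem edge_eq_of_r_eq {e e' : (kriegerCover X).E}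
    (hr : (kriegerCover X).r e = (kriegerCover X).r e')
    (hl : (kriegerCover X).label e = (kriegerCover X).label e') : e = e' := by
  obtain ⟨⟨P, a, Q⟩, x, hx, h1, h2⟩ := e
  obtain ⟨⟨P', a', Q'⟩, x', hx', h1', h2'⟩ := e'
  change Q = Q' at hr
  change a = a' at hl
  subst hr hl
  have hP : P = P' := Subtype.ext
    (h1.trans ((pred_cons_congr (h2.symm.trans h2') a).trans h1'.symm))
  subst hP
  rfl

theorem edgeAt_congr {x y : X.carrier} {n m : ℤ} (hv : vertexAt x (n + 1) = vertexAt y (m + 1))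
    (h : x.1 n = y.1 m) : edgeAt x n = edgeAt y m :=
  edge_eq_of_r_eq hv h

theorem vertexAt_shiftBy (x : X.carrier) (i n : ℤ) :
    vertexAt (shiftBy X i x) n = vertexAt x (i + n) := by
  refine Subtype.ext (congrArg (pred X) (funext fun k => ?_))
  change x.1 (i + (n + k)) = x.1 (i + n + k)
  rw [add_assoc]

theorem edgeAt_shiftBy (x : X.carrier) (i n : ℤ) :
    edgeAt (shiftBy X i x) n = edgeAt x (i + n) :=
  edgeAt_congr (by rw [vertexAt_shiftBy, add_assoc]) rfl

/-- The edges of the path `p` to the left of `n` are those given by `x`. -/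
def Represents (p : (kriegerCover X).edgeShift.carrier) (x : X.carrier) (n : ℤ) : Prop :=
  ∀ i < n, p.1 i = edgeAt x i

theorem Represents.mono {p : (kriegerCover X).edgeShift.carrier} {x : X.carrier} {m n : ℤ}
    (h : Represents p x n) (hmn : m ≤ n) : Represents p x m :=
  fun i hi => h i (by omega)

theorem Represents.shift {p : (kriegerCover X).edgeShift.carrier} {x : X.carrier} {n : ℤ}
    (h : Represents p x n) :
    Represents (shiftMap _ p) (shiftBy X 1 x) (n - 1) := fun i hi => by
  rw [edgeAt_shiftBy]
  exact h _ (by omega)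

theorem eq_of_represents {p q : (kriegerCover X).edgeShift.carrier}
    (h : ∀ n, ∃ x m, n < m ∧ Represents p x m ∧ Represents q x m) : p = q := by
  ext n : 2
  obtain ⟨x, m, hm, hp, hq⟩ := h n
  rw [hp n hm, hq n hm]

/-- Since the cover is left-resolving, the vertex at `n` and the labels before it force all earlier
edges. -/
theorem Represents.of_vertex {p : (kriegerCover X).edgeShift.carrier} {x : X.carrier} {n : ℤ}
    (hl : ∀ i < n, (kriegerCover X).label (p.1 i) = x.1 i)
    (hv : (kriegerCover X).s (p.1 n) = vertexAt x n) : Represents p x n := by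
  have key : ∀ k : ℕ, (kriegerCover X).s (p.1 (n - k)) = vertexAt x (n - k) ∧
      p.1 (n - k - 1) = edgeAt x (n - k - 1) := by
    have step : ∀ m ≤ n, (kriegerCover X).s (p.1 m) = vertexAt x m →
        p.1 (m - 1) = edgeAt x (m - 1) := by
      intro m hm h
      refine edge_eq_of_r_eq ?_ (hl _ (by omega))
      have := p.2 (m - 1)
      rw [sub_add_cancel] at this
      rw [this, h, r_edgeAt, sub_add_cancel]
    intro k
    induction k with
    | zero =>
      rw [Nat.cast_zero, sub_zero]
      exact ⟨hv, step n le_rfl hv⟩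
    | succ k ih =>
      have e : n - ((k + 1 : ℕ) : ℤ) = n - k - 1 := by push_cast; ring
      rw [e]
      have h : (kriegerCover X).s (p.1 (n - k - 1)) = vertexAt x (n - k - 1) := by
        rw [ih.2, s_edgeAt]
      exact ⟨h, step _ (by omega) h⟩
  intro i hi
  have := (key (n - i - 1).toNat).2
  rwa [show n - ((n - i - 1).toNat : ℤ) - 1 = i by omega] at this

theorem exists_represents [DiscreteTopology A] (p : (kriegerCover X).edgeShift.carrier) (n : ℤ) :
    ∃ x, Represents p x n := by
  let l : ℤ → A := fun i => (kriegerCover X).label (p.1 i)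
  -- Each vertex contains left-rays agreeing with the labels of `p` on arbitrarily long final
  -- blocks. Closedness of `X` then puts the full label past in front of a right-ray of that vertex.
  have key : ∀ (k : ℕ) (n : ℤ), ∃ y ∈ ((kriegerCover X).s (p.1 n)).1,
      ∀ j : ℕ, j < k → y j = leftRay l n j := by
    intro k
    induction k with
    | zero =>
      intro n
      obtain ⟨y, hy⟩ := vertex_nonempty ((kriegerCover X).s (p.1 n))
      exact ⟨y, hy, fun j hj => absurd hj (Nat.not_lt_zero j)⟩
    | succ k ih =>
      intro n
      obtain ⟨y, hy, hyl⟩ := ih (n - 1)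
      refine ⟨cons (l (n - 1)) y, ?_, fun j hj => ?_⟩
      · have h := cons_mem_of_edge X _ hy
        rwa [p.2 (n - 1), sub_add_cancel] at h
      · have hc := leftRay_add_one l (n - 1)
        rw [sub_add_cancel] at hc
        rw [hc]
        cases j with
        | zero => rfl
        | succ j => exact hyl j (by omega)
  obtain ⟨x, hx⟩ := exists_vertexAt_eq ((kriegerCover X).s (p.1 n)) n
  have hmem : glue n l x.1 ∈ X.carrier := by
    choose y hy hyl using fun k => key k n
    choose z hz using fun k => exists_leftRay_eq (y k) n
    have hzX : ∀ k, glue n (z k) x.1 ∈ X.carrier := fun k => by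
      rw [← leftRay_mem_past, hz]
      have := hy k
      rwa [← hx] at this
    refine X.isClosed.mem_of_tendsto (b := Filter.atTop) ?_ (Filter.Eventually.of_forall hzX)
    rw [tendsto_pi_nhds]
    intro m
    refine tendsto_nhds_of_eventually_eq ?_
    filter_upwards [Filter.eventually_ge_atTop (n - m).toNat] with k hk
    by_cases hm : m < n
    · rw [glue_of_lt hm, glue_of_lt hm]
      have h := hyl k (n - 1 - m).toNat (by omega)
      rw [← hz] at h
      have e : n - 1 - ((n - 1 - m).toNat : ℤ) = m := by omega
      simpa only [leftRay, e] using h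
    · rw [glue_of_le (by omega), glue_of_le (by omega)]
  refine ⟨⟨_, hmem⟩, Represents.of_vertex (fun i hi => (glue_of_lt hi l x.1).symm) ?_⟩
  rw [← hx]
  exact Subtype.ext (past_congr fun i hi => (glue_of_le hi l x.1).symm)

end Paths

/-! ### Lifting conjugacies to the left Krieger cover -/

section Lift

variable {A : Type u} {B : Type v} [TopologicalSpace A] [TopologicalSpace B]
  {X : Subshift A ℤ} {Y : Subshift B ℤ} {f : X.carrier → Y.carrier} {g : Y.carrier → X.carrier}
  {N : ℕ}

theorem InverseCodes.vertexAt_eq (h : InverseCodes f g N) {x x' : X.carrier} {i n : ℤ}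
    (hin : i + 3 * N ≤ n) (hxx : ∀ j, i - N ≤ j → j < n → x.1 j = x'.1 j)
    (hp : vertexAt x n = vertexAt x' n) : vertexAt (f x) i = vertexAt (f x') i :=
  Subtype.ext (h.past_eq x x' hin hxx (congrArg Subtype.val hp))

theorem InverseCodes.edgeAt_eq (h : InverseCodes f g N) {x x' : X.carrier} {i : ℤ}
    (hxx : ∀ j, i - N ≤ j → j < i + 3 * N + 1 → edgeAt x j = edgeAt x' j) :
    edgeAt (f x) i = edgeAt (f x') i := by
  have hl : ∀ j, i - N ≤ j → j < i + 3 * N + 1 → x.1 j = x'.1 j := fun j h1 h2 =>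
    congrArg (kriegerCover X).label (hxx j h1 h2)
  -- An edge is fixed by its label and its end vertex. The end vertex sits at `i + 1`, so the
  -- exchange bound asks for `n = i + 1 + 3N`.
  refine edgeAt_congr (h.vertexAt_eq (n := i + 3 * N + 1) (by omega)
    (fun j h1 h2 => hl j (by omega) h2) ?_)
    (h.code _ _ i fun j h1 h2 => hl j h1 (by omega))
  exact congrArg (kriegerCover X).r (hxx (i + 3 * N) (by omega) (by omega))

variable [DiscreteTopology A]

/-- The lift of a conjugacy to the left Krieger covers. -/
noncomputable def InverseCodes.lift (h : InverseCodes f g N)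
    (p : (kriegerCover X).edgeShift.carrier) : (kriegerCover Y).edgeShift.carrier :=
  ⟨fun i => edgeAt (f (exists_represents p (i + 3 * N + 1)).choose) i, fun i => by
    have h1 := (exists_represents p (i + 3 * N + 1)).choose_spec
    have h2 := (exists_represents p (i + 1 + 3 * N + 1)).choose_spec
    -- The points chosen for `i` and `i + 1` may differ, but both follow `p` on the window that
    -- determines the image edge at `i`.
    rw [r_edgeAt, s_edgeAt, ← r_edgeAt, ← r_edgeAt]
    refine congrArg _ (h.edgeAt_eq fun j _ hj => ?_)
    rw [← h1 j hj, ← h2 j (by omega)]⟩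

theorem InverseCodes.represents_lift (h : InverseCodes f g N)
    {p : (kriegerCover X).edgeShift.carrier} {x : X.carrier} {n : ℤ} (hx : Represents p x n) :
    Represents (h.lift p) (f x) (n - 3 * N) := fun i hi => by
  have h1 := (exists_represents p (i + 3 * N + 1)).choose_spec
  refine h.edgeAt_eq fun j _ hj => ?_
  rw [← h1 j hj, hx j (by omega)]

theorem InverseCodes.lift_apply_congr (h : InverseCodes f g N)
    {p q : (kriegerCover X).edgeShift.carrier} {i : ℤ}
    (hpq : ∀ j, i - N ≤ j → j < i + 3 * N + 1 → p.1 j = q.1 j) :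
    (h.lift p).1 i = (h.lift q).1 i := by
  have h1 := (exists_represents p (i + 3 * N + 1)).choose_spec
  have h2 := (exists_represents q (i + 3 * N + 1)).choose_spec
  refine h.edgeAt_eq fun j hj hj' => ?_
  rw [← h1 j hj', ← h2 j hj', hpq j hj hj']

theorem InverseCodes.lift_lift [DiscreteTopology B] (h : InverseCodes f g N)
    (p : (kriegerCover X).edgeShift.carrier) : h.symm.lift (h.lift p) = p :=
  eq_of_represents fun n => by
    -- Each of the two lifts costs `3N` positions on the right.
    obtain ⟨x, hx⟩ := exists_represents p (n + 6 * N + 1)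
    have h2 := h.symm.represents_lift (h.represents_lift hx)
    rw [h.left_inv] at h2
    exact ⟨x, n + 1, by omega, h2.mono (by omega), hx.mono (by omega)⟩

theorem InverseCodes.lift_shiftMap (h : InverseCodes f g N)
    (p : (kriegerCover X).edgeShift.carrier) :
    h.lift (shiftMap _ p) = shiftMap _ (h.lift p) :=
  eq_of_represents fun n => by
    obtain ⟨x, hx⟩ := exists_represents p (n + 3 * N + 2)
    have h1 := h.represents_lift hx.shift
    rw [h.shift] at h1
    exact ⟨_, n + 1, by omega, h1.mono (by omega), (h.represents_lift hx).shift.mono (by omega)⟩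

theorem InverseCodes.label_lift (h : InverseCodes f g N)
    (p : (kriegerCover X).edgeShift.carrier) (x : X.carrier)
    (hx : ∀ i, x.1 i = (kriegerCover X).label (p.1 i)) (i : ℤ) :
    (kriegerCover Y).label ((h.lift p).1 i) = (f x).1 i := by
  obtain ⟨w, hw⟩ := exists_represents p (i + 3 * N + 1)
  rw [h.represents_lift hw i (by omega), label_edgeAt]
  refine h.code _ _ i fun j _ h2 => ?_
  rw [hx, hw j (by omega), label_edgeAt]

end Lift

/-! ### Non-decomposable vertices -/

section NonDecomposable

variable {A : Type u} [TopologicalSpace A] {X : Subshift A ℤ}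

/-- Otherwise the vertices properly contained in `P` would cover it, and `P` is not among them. -/
theorem NonDecomposable.exists_mem {P : (kriegerCover X).V} (hP : NonDecomposable X P) :
    ∃ y ∈ P.1, ∀ Q : (kriegerCover X).V, Q.1 ⊆ P.1 → y ∈ Q.1 → Q = P := by
  by_contra! hne
  refine (hP {Q | Q.1 ⊆ P.1 ∧ Q ≠ P} ?_).2 rfl
  ext y
  simp only [Set.mem_iUnion, Set.mem_ofPred_eq, exists_prop]
  constructor
  · intro hy
    obtain ⟨Q, h1, h2, h3⟩ := hne y hy
    exact ⟨Q, ⟨h1, h3⟩, h2⟩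
  · rintro ⟨Q, ⟨h1, -⟩, h2⟩
    exact h1 h2

/-- Take `Q` minimal among the finitely many vertices inside `P` that contain `y`. If `Q` is a union
of vertices, the one containing `y` is `Q` by minimality. -/
theorem exists_nonDecomposable [Finite (kriegerCover X).V] (P : (kriegerCover X).V) {y : ℕ → A}
    (hy : y ∈ P.1) : ∃ Q : (kriegerCover X).V, NonDecomposable X Q ∧ y ∈ Q.1 ∧ Q.1 ⊆ P.1 := by
  let S : Set (Set (ℕ → A)) := Subtype.val '' {Q : (kriegerCover X).V | y ∈ Q.1 ∧ Q.1 ⊆ P.1}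
  have hS : S.Finite :=
    ((Set.finite_univ (α := (kriegerCover X).V)).subset (Set.subset_univ _)).image _
  obtain ⟨_, hm⟩ := hS.exists_minimal ⟨_, P, ⟨hy, subset_rfl⟩, rfl⟩
  obtain ⟨Q, ⟨hyQ, hQP⟩, rfl⟩ := hm.prop
  refine ⟨Q, fun V hV => ?_, hyQ, hQP⟩
  rw [hV] at hyQ
  obtain ⟨R, hR, hyR⟩ := Set.mem_iUnion₂.1 hyQ
  have hRQ : R.1 ⊆ Q.1 := fun z hz => hV ▸ Set.mem_iUnion₂.2 ⟨R, hR, hz⟩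
  have : Q = R := Subtype.ext
    ((hm.le_of_le ⟨R, ⟨hyR, hRQ.trans hQP⟩, rfl⟩ hRQ).antisymm hRQ)
  rwa [this]

theorem connectedTo_vertexAt (x : X.carrier) {m n : ℤ} (h : m ≤ n) :
    (kriegerCover X).ConnectedTo (vertexAt x m) (vertexAt x n) := by
  obtain ⟨k, rfl⟩ := Int.le.dest h
  induction k with
  | zero =>
    rw [Nat.cast_zero, add_zero]
    exact Relation.ReflTransGen.refl
  | succ k ih =>
    refine (ih (by omega)).tail ⟨edgeAt x (m + k), rfl, ?_⟩
    rw [r_edgeAt, add_assoc, Nat.cast_succ]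

/-- A point can be modified from position `n` on so as to follow a given finite path. -/
theorem exists_vertexAt_of_connectedTo {P P' : (kriegerCover X).V}
    (h : (kriegerCover X).ConnectedTo P P') (x : X.carrier) (n : ℤ) (hx : vertexAt x n = P) :
    ∃ (y : X.carrier) (m : ℤ), n ≤ m ∧ (∀ i < n, y.1 i = x.1 i) ∧ vertexAt y n = P ∧
      vertexAt y m = P' := by
  induction h using Relation.ReflTransGen.head_induction_on generalizing x n with
  | refl => exact ⟨x, n, le_rfl, fun _ _ => rfl, hx, hx⟩
  | @head P Q e _ ih =>
    obtain ⟨⟨⟨P, a, Q⟩, r, hr, h1, h2⟩, rfl, rfl⟩ := e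
    change P.1 = pred X (cons a r) at h1
    change Q.1 = pred X r at h2
    obtain ⟨z, hz⟩ := exists_rightRay_eq (cons a r) n
    have hz1 : past X z n = P.1 := by rw [past, hz, h1]
    have hz2 : past X z (n + 1) = Q.1 := by
      rw [rightRay_eq_cons] at hz
      have : rightRay z (n + 1) = r := funext fun k => congrFun hz (k + 1)
      rw [past, this, h2]
    have hw : glue n x.1 z ∈ X.carrier := by
      rw [← leftRay_mem_past, hz1]
      exact (congrArg Subtype.val hx : past X x.1 n = P.1) ▸ leftRay_mem_vertexAt x n
    obtain ⟨y, m, hm, hy, hyQ, hyP'⟩ := ih ⟨_, hw⟩ (n + 1) (Subtype.ext <| by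
      refine (past_congr fun i hi => ?_).trans hz2
      exact glue_of_le (by omega) _ _)
    refine ⟨y, m, by omega, fun i hi => ?_, Subtype.ext ?_, hyP'⟩
    · rw [hy i (by omega)]
      exact glue_of_lt hi _ _
    -- Later changes leave the letter at `n` and the vertex at `n + 1` alone, which determine the
    -- vertex at `n`.
    · refine Eq.trans (past_of_past_eq (n := n + 1) (by omega) ?_ fun i hi hi' => ?_) hz1
      · exact (congrArg Subtype.val hyQ).trans hz2.symm
      · rw [hy i hi']
        exact glue_of_le hi _ _

end NonDecomposable

/-! ### Sofic shifts have finitely many predecessor sets -/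

section Finite

variable {A : Type u} [TopologicalSpace A]

/-- With `M` bounding the forbidden lengths, a forbidden word starting left of `0` ends before `M`
and so occurs in `x`; any other occurs in `y`. -/
theorem IsSFT.exists_glue_mem {X : Subshift A ℤ} (hX : IsSFT X) :
    ∃ M : ℕ, ∀ x ∈ X.carrier, ∀ y ∈ X.carrier, (∀ i : ℤ, -M ≤ i → i < M → x i = y i) →
      glue 0 x y ∈ X.carrier := by
  obtain ⟨F, hF, hXF⟩ := hX
  obtain ⟨M, hM⟩ := (hF.image List.length).bddAbove
  refine ⟨M, fun x hx y hy hxy => ?_⟩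
  rw [hXF] at hx hy ⊢
  rintro w hw ⟨i, hi⟩
  have hlen : w.length ≤ M := hM ⟨w, hw, rfl⟩
  by_cases h0 : i < 0
  · refine hx w hw ⟨i, fun k => ?_⟩
    rw [← hi k]
    have := k.2
    by_cases hk : i + (k : ℕ) < 0
    · rw [glue_of_lt hk]
    · rw [glue_of_le (by omega), hxy _ (by omega) (by omega)]
  · refine hy w hw ⟨i, fun k => ?_⟩
    rw [← hi k, glue_of_le (by omega)]

theorem IsSofic.finite_vertices [DiscreteTopology A] {X : Subshift A ℤ} (hX : IsSofic X) :
    Finite (kriegerCover X).V := by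
  obtain ⟨n, Y, f, hY, hf⟩ := hX
  obtain ⟨M₁, hM₁⟩ := hY.exists_glue_mem
  obtain ⟨M₂, hM₂⟩ := exists_isBlockCode hf.continuous hf.semiconj
  let M := max M₁ M₂
  -- `S x` records the central blocks of points of `Y` whose image has the right-ray of `x`. It
  -- determines the predecessor set, since two points of `Y` with the same central block can be
  -- spliced at `0`, and only finitely many values are possible.
  let S : X.carrier → Set (Set.Ico (-M : ℤ) M → Fin n) := fun x =>
    {b | ∃ w : Y.carrier, (∀ i, w.1 i.1 = b i) ∧ ∀ i, 0 ≤ i → (f w).1 i = x.1 i}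
  have key : ∀ x x' : X.carrier, S x ⊆ S x' → past X x.1 0 ⊆ past X x'.1 0 := by
    intro x x' hS
    rw [past_subset_iff]
    intro z hz
    obtain ⟨w, hw⟩ := hf.surjective ⟨_, hz⟩
    have hw' : ∀ i, (f w).1 i = glue 0 z x.1 i := fun i => by rw [hw]
    obtain ⟨w', hb, hx'⟩ := hS (show (fun i => w.1 i.1) ∈ S x from
      ⟨w, fun _ => rfl, fun i hi => (hw' i).trans (glue_of_le hi _ _)⟩)
    have hww : ∀ i : ℤ, -M ≤ i → i < M → w.1 i = w'.1 i := fun i h1 h2 => (hb ⟨i, h1, h2⟩).symm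
    let v : Y.carrier := ⟨_, hM₁ w.1 w.2 w'.1 w'.2 fun i h1 h2 => hww i (by omega) (by omega)⟩
    rw [show glue 0 z x'.1 = (f v).1 from ?_]
    · exact (f v).2
    · funext i
      by_cases hi : i < 0
      · rw [glue_of_lt hi, ← glue_of_lt hi z x.1, ← hw' i]
        refine hM₂ _ _ i fun j h1 h2 => ?_
        change _ = glue 0 w.1 w'.1 j
        by_cases hj : j < 0
        · rw [glue_of_lt hj]
        · rw [glue_of_le (by omega), hww j (by omega) (by omega)]
      · rw [glue_of_le (by omega), ← hx' i (by omega)]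
        refine hM₂ _ _ i fun j h1 h2 => ?_
        change _ = glue 0 w.1 w'.1 j
        by_cases hj : j < 0
        · rw [glue_of_lt hj, hww j (by omega) (by omega)]
        · rw [glue_of_le (by omega)]
  choose x hx using fun P : (kriegerCover X).V => exists_vertexAt_eq P 0
  refine Finite.of_injective (fun P => S (x P)) fun P Q hPQ => ?_
  rw [← hx P, ← hx Q]
  exact Subtype.ext ((key _ _ (le_of_eq hPQ)).antisymm (key _ _ (le_of_eq hPQ.symm)))

end Finite

/-! ### Lifting conjugacies to the generalized left Fischer cover -/

section Fischer

variable {A : Type u} {B : Type v} [TopologicalSpace A] [TopologicalSpace B]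
  {X : Subshift A ℤ} {Y : Subshift B ℤ} {f : X.carrier → Y.carrier} {g : Y.carrier → X.carrier}
  {N : ℕ}

/-- The vertices of the generalized left Fischer cover. -/
def fischerVertices (X : Subshift A ℤ) : Set (kriegerCover X).V :=
  {P | ∃ P' : (kriegerCover X).V, NonDecomposable X P' ∧ (kriegerCover X).ConnectedTo P P'}

theorem InverseCodes.vertexAt_mem_fischerVertices [Finite (kriegerCover Y).V]
    (h : InverseCodes f g N) {x : X.carrier} {i n : ℤ} (hin : i + 3 * N ≤ n)
    (hx : vertexAt x n ∈ fischerVertices X) : vertexAt (f x) i ∈ fischerVertices Y := by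
  obtain ⟨P, hP, hc⟩ := hx
  obtain ⟨w, m, hnm, hwx, hwn, rfl⟩ := exists_vertexAt_of_connectedTo hc x n rfl
  obtain ⟨y, hy, hmin⟩ := hP.exists_mem
  obtain ⟨z, rfl⟩ := exists_leftRay_eq y m
  let t : X.carrier := ⟨_, leftRay_mem_past.1 hy⟩
  have ht : vertexAt t m = vertexAt w m :=
    Subtype.ext (past_congr fun i hi => glue_of_le hi _ _)
  -- The least position allowed by `past_subset_of_glue`.
  let j := m + 3 * N
  obtain ⟨Q, hQ, htQ, hQt⟩ := exists_nonDecomposable (vertexAt (f t) j)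
    (leftRay_mem_vertexAt (f t) j)
  obtain ⟨s, rfl⟩ := exists_vertexAt_eq Q j
  have hv : glue j (f t).1 s.1 ∈ Y.carrier := leftRay_mem_past.1 htQ
  let v : Y.carrier := ⟨_, hv⟩
  have hgv : ∀ i < j - N, (g v).1 i = t.1 i := fun i hi => by
    rw [← h.left_inv t]
    exact h.code_inv _ _ i fun k _ h2 => glue_of_lt (by omega) _ _
  -- Switching to the tail of `Q` shrinks the predecessor set at `m` but keeps `y` in it, so the
  -- choice of `y` forces equality.
  have hgm : vertexAt (g v) m = vertexAt w m := by
    refine hmin _ ?_ ?_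
    · rw [← ht]
      exact h.past_subset_of_glue t s.1 le_rfl hv hQt
    · have := leftRay_mem_vertexAt (g v) m
      rwa [leftRay_congr (y := z) fun i hi => (hgv i (by omega)).trans (glue_of_lt hi _ _)] at this
  have hr : glue m w.1 (g v).1 ∈ X.carrier := by
    rw [← leftRay_mem_past]
    have := leftRay_mem_vertexAt w m
    rwa [← hgm] at this
  -- `r` has the past of `w`, hence the same vertex as `x` at `n`, and the future of `g v`, hence an
  -- image passing through `Q` at `j`.
  let r : X.carrier := ⟨_, hr⟩
  have hrm : vertexAt r m = vertexAt w m :=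
    (Subtype.ext (past_congr fun i hi => glue_of_le hi _ _)).trans hgm
  have hrn : vertexAt r n = vertexAt x n :=
    (Subtype.ext (past_of_past_eq hnm (congrArg Subtype.val hrm)
      fun i _ hi => glue_of_lt hi _ _)).trans hwn
  have hfr : vertexAt (f r) j = vertexAt s j := by
    refine Subtype.ext (past_congr fun i hi => ?_)
    rw [← show v.1 i = s.1 i from glue_of_le hi _ _, ← h.right_inv v]
    exact h.code _ _ i fun k h1 _ => glue_of_le (by omega) _ _
  refine ⟨_, hQ, ?_⟩
  rw [← hfr, h.vertexAt_eq hin (x' := r) (fun k _ hk => ?_) hrn.symm]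
  · exact connectedTo_vertexAt _ (by omega)
  · rw [← hwx k hk]
    exact (glue_of_lt (by omega) _ _).symm

theorem InverseCodes.lift_mem_fischerVertices [DiscreteTopology A] [Finite (kriegerCover Y).V]
    (h : InverseCodes f g N) {p : (kriegerCover X).edgeShift.carrier}
    (hp : ∀ i, (kriegerCover X).s (p.1 i) ∈ fischerVertices X) (i : ℤ) :
    (kriegerCover Y).s ((h.lift p).1 i) ∈ fischerVertices Y := by
  obtain ⟨x, hx⟩ := exists_represents p (i + 3 * N + 1)
  rw [h.represents_lift hx i (by omega), s_edgeAt]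
  refine h.vertexAt_mem_fischerVertices le_rfl ?_
  rw [← s_edgeAt, ← hx _ (by omega)]
  exact hp _

/-- A path in the generalized left Fischer cover, as a path in the left Krieger cover. -/
def fischerToKrieger (X : Subshift A ℤ) (p : (genFischerCover X).edgeShift.carrier) :
    (kriegerCover X).edgeShift.carrier :=
  ⟨fun i => (p.1 i).1, fun i => congrArg Subtype.val (p.2 i)⟩

theorem fischerToKrieger_injective (X : Subshift A ℤ) :
    Function.Injective (fischerToKrieger X) := fun _ _ h =>
  Subtype.ext (funext fun i => Subtype.ext (congrFun (congrArg Subtype.val h) i))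

/-- The lift of a conjugacy to the generalized left Fischer covers. -/
noncomputable def InverseCodes.fischerLift [DiscreteTopology A] [Finite (kriegerCover Y).V]
    (h : InverseCodes f g N) (p : (genFischerCover X).edgeShift.carrier) :
    (genFischerCover Y).edgeShift.carrier :=
  have hs := h.lift_mem_fischerVertices (p := fischerToKrieger X p) fun i => (p.1 i).2.1
  ⟨fun i => ⟨(h.lift (fischerToKrieger X p)).1 i, hs i,
      ((h.lift (fischerToKrieger X p)).2 i).symm ▸ hs (i + 1)⟩,
    fun i => Subtype.ext ((h.lift (fischerToKrieger X p)).2 i)⟩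

theorem InverseCodes.fischerToKrieger_fischerLift [DiscreteTopology A]
    [Finite (kriegerCover Y).V] (h : InverseCodes f g N)
    (p : (genFischerCover X).edgeShift.carrier) :
    fischerToKrieger Y (h.fischerLift p) = h.lift (fischerToKrieger X p) := rfl

theorem InverseCodes.fischerLift_fischerLift [DiscreteTopology A] [DiscreteTopology B]
    [Finite (kriegerCover X).V] [Finite (kriegerCover Y).V] (h : InverseCodes f g N)
    (p : (genFischerCover X).edgeShift.carrier) :
    h.symm.fischerLift (h.fischerLift p) = p := by
  apply fischerToKrieger_injective
  rw [fischerToKrieger_fischerLift, fischerToKrieger_fischerLift, h.lift_lift]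

theorem InverseCodes.continuous_fischerLift [DiscreteTopology A] [Finite (kriegerCover Y).V]
    (h : InverseCodes f g N) : Continuous h.fischerLift := by
  refine Continuous.subtype_mk (continuous_pi fun i => ?_) _
  refine IsLocallyConstant.continuous ((IsLocallyConstant.iff_eventually_eq _).2 fun p => ?_)
  have hU : ∀ j : ℤ, ∀ᶠ q : (genFischerCover X).edgeShift.carrier in nhds p, q.1 j = p.1 j :=
    fun j => ((continuous_apply j).comp continuous_subtype_val).continuousAt.eventually_mem
      ((isOpen_discrete {p.1 j}).mem_nhds rfl)
  filter_upwards [(Filter.eventually_all_finset (Finset.Icc (i - N) (i + 3 * N))).2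
    fun j _ => hU j] with q hq
  refine Subtype.ext (h.lift_apply_congr fun j h1 h2 => congrArg Subtype.val (hq j ?_))
  exact Finset.mem_Icc.2 ⟨h1, by omega⟩

theorem InverseCodes.isConjugacy_fischerLift [DiscreteTopology A] [DiscreteTopology B]
    [Finite (kriegerCover X).V] [Finite (kriegerCover Y).V] (h : InverseCodes f g N) :
    IsConjugacy h.fischerLift where
  continuous := h.continuous_fischerLift
  bijective := Function.bijective_iff_has_inverse.2
    ⟨h.symm.fischerLift, h.fischerLift_fischerLift, h.symm.fischerLift_fischerLift⟩
  semiconj p := fischerToKrieger_injective Y (h.lift_shiftMap (fischerToKrieger X p))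

end Fischer

end Sofic

theorem mainTheorem1 {A₁ : Type u} {A₂ : Type v} [Finite A₁] [Finite A₂]
    [TopologicalSpace A₁] [DiscreteTopology A₁] [TopologicalSpace A₂] [DiscreteTopology A₂]
    (X₁ : Subshift A₁ ℤ) (X₂ : Subshift A₂ ℤ)
    (hX₁ : Sofic.IsSofic X₁) (hX₂ : Sofic.IsSofic X₂)
    (Φ : X₁.carrier → X₂.carrier) (hΦ : Sofic.IsConjugacy Φ) :
    ∃ ψ : (Sofic.genFischerCover X₁).edgeShift.carrier →
        (Sofic.genFischerCover X₂).edgeShift.carrier,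
      Sofic.IsConjugacy ψ ∧
        Φ ∘ Sofic.coveringMap X₁ = Sofic.coveringMap X₂ ∘ ψ := by
  -- Soficity enters only through these two finiteness statements. Both are needed, since the
  -- inverse lift must preserve Fischer vertices too.
  have := hX₁.finite_vertices
  have := hX₂.finite_vertices
  obtain ⟨g, N, h⟩ := hΦ.exists_inverseCodes
  refine ⟨h.fischerLift, h.isConjugacy_fischerLift,
    funext fun p => Subtype.ext (funext fun i => ?_)⟩
  exact (h.label_lift (Sofic.fischerToKrieger X₁ p) (Sofic.coveringMap X₁ p) (fun _ => rfl) i).symm
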